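/- **Model.** Agents $i\in\{1,\dots,n\}$ control a system with finite-valued variables $X_{t+1}=f(X_t,\mathbf U_t,W^s_t)$, $\mathbf Y_t=h(X_t,\mathbf U_{t-1},W^o_t)$, $t\ge 1$ (with a fixed value $\mathbf u_0$ in place of $\mathbf U_0$), where $X_1\sim P_X$, $(W^s_t)_t$ i.i.d. $\sim P_{W^s}$ and $(W^o_t)_t$ i.i.d. $\sim P_{W^o}$ are mutually independent. The information structure is (time-invariant) partial history sharing: at time $t$ agent $i$ knows the common information $C_t=Z_{1:t-1}$ and its local information $M^i_t\in\mathcal M^i$, where $\mathcal M^i$ and $\mathcal Z$ are finite, $M^i_1$ is a function of $Y^i_1$, $M^i_{t+1}=\xi^i(M^i_t,U^i_t,Y^i_{t+1})$, and the common observation is $Z_t=\zeta(\mathbf M_t,\mathbf U_t,\mathbf Y_{t+1})\in\mathcal Z$. A joint strategy $\boldsymbol g$ chooses $U^i_t=g^i_t(C_t,M^i_t)$ and has cost $J(\boldsymbol g)=\mathbb E^{\boldsymbol g}\big[\sum_{t\ge1}\beta^{t-1}\ell(X_t,\mathbf U_t)\big]$, $\beta\in(0,1)$. In the coordinated system, a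 coordination strategy $\boldsymbol\psi$ chooses a prescription $\boldsymbol\Gamma_t=\boldsymbol\psi_t(C_t)\in\mathcal G:=\prod_i\{\mathcal M^i\to\mathcal U^i\}$, the actions are $U^i_t=\Gamma^i_t(M^i_t)$, and the cost is $J(\boldsymbol\psi)=\mathbb E^{\boldsymbol\psi}\big[\sum_{t\ge1}\beta^{t-1}\ell(X_t,\mathbf U_t)\big]$. Optimal means of minimal cost among all joint (resp. coordination) strategies. **Information state.** Let $\pi_1$ be the law of $(X_1,\mathbf M_1)$, let $\phi(\pi,\boldsymbol\gamma,z)$ be the conditional law of $(X_{t+1},\mathbf M_{t+1})$ given $Z_t=z$ when $(X_t,\mathbf M_t)\sim\pi$ and $\boldsymbol\Gamma_t=\boldsymbol\gamma$ (an arbitrary but fixed distribution, which may depend on $(\pi,\boldsymbol\gamma,z)$, if $Z_t=z$ has probability $0$), and let $\hat\ell(\pi,\boldsymbol\gamma)$ be the expected per-step cost when $(X_t,\mathbf M_t)\sim\pi$ and $\boldsymbol\Gamma_t=\boldsymbol\gamma$. Let $\mathcal R$ be the set of all $\pi$ obtained from $\pi_1$ by finitely many applications of $\phi(\cdot,\boldsymbol\gamma,z)$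 with $\boldsymbol\gamma\in\mathcal G$, $z\in\mathcal Z$. A map $\boldsymbol\psi:\mathcal R\to\mathcal G$ is regarded as the coordination strategy $\boldsymbol\Gamma_t=\boldsymbol\psi(\Pi_t)$, where $\Pi_1=\pi_1$ and $\Pi_{t+1}=\phi(\Pi_t,\boldsymbol\Gamma_t,Z_t)$. **The MDP $\Delta$.** Let $\langle\{\mathcal S_k\}_{k\ge1},B,\tilde f\rangle$ be an incrementally expanding representation: finite sets $\{s^*\}=\mathcal S_1\subsetneq\mathcal S_2\subsetneq\cdots$ with union $\mathcal S$, a surjection $B:\mathcal S\to\mathcal R$, and $\tilde f:\mathcal S\times\mathcal G\times\mathcal Z\to\mathcal S$ such that $\tilde f(s,\boldsymbol\gamma,z)\in\mathcal S_{k+1}$ for $s\in\mathcal S_k$, and such that for every sequence $(\boldsymbol\gamma_k,z_k)_{k<t}$ the states $\pi_t$ and $s_t$ generated by $\phi$ from $\pi_1$ and by $\tilde f$ from $s^*$ satisfy $\pi_t=B(s_t)$. $\Delta$ is the MDP with state space $\mathcal S$, actions $\mathcal G$, $S_1=s^*$, $S_{t+1}=\tilde f(S_t,\boldsymbol\Gamma_t,Z_t)$,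 where given $S_t=s,\boldsymbol\Gamma_t=\boldsymbol\gamma$ the variable $Z_t$ has the law it has when $\Pi_t=B(s)$ and $\boldsymbol\Gamma_t=\boldsymbol\gamma$, and with cost $\tilde\ell(s,\boldsymbol\gamma)=\hat\ell(B(s),\boldsymbol\gamma)$. For a stationary strategy $\tilde{\boldsymbol\psi}:\mathcal S\to\mathcal G$ let $\tilde J(\tilde{\boldsymbol\psi})=\mathbb E^{\tilde{\boldsymbol\psi}}\big[\sum_{t\ge1}\beta^{t-1}\tilde\ell(S_t,\boldsymbol\Gamma_t)\big]$. **Lemma.** Let $\tilde{\boldsymbol\psi}^*$ minimize $\tilde J$ over all stationary strategies of $\Delta$. 1. If $\boldsymbol\psi^*:\mathcal R\to\mathcal G$ satisfies $\boldsymbol\psi^*(B(s))=\tilde{\boldsymbol\psi}^*(s)$ for all $s\in\mathcal S$, then $\tilde J(\tilde{\boldsymbol\psi}^*)=J(\boldsymbol\psi^*)$, $\boldsymbol\psi^*$ is an optimal strategy of the coordinated system, and the joint strategy $U^i_t=\boldsymbol\psi^{*,i}(\Pi_t)(M^i_t)$ is an optimal strategy of the decentralized system. 2. In any case (that is, even if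 $\tilde{\boldsymbol\psi}^*$ is not constant on the fibres of $B$, so that no $\boldsymbol\psi^*$ as in 1 exists) one can choose for each $\pi\in\mathcal R$ a state $s_\pi$ with $B(s_\pi)=\pi$ such that $\boldsymbol\psi^*(\pi):=\tilde{\boldsymbol\psi}^*(s_\pi)$ has all the properties in the conclusion of 1. -/

import Mathlib

open MeasureTheory ProbabilityTheory

noncomputable section

universe u₁ u₂ u₃ u₄ u₅ u₆ u₇ u₈ u₉ u₁₀

/-- A decentralized control system with partial history sharing and agents indexed by `ι`.

* `𝓧`, `𝓨 i`, `𝓤 i`: values of the state, of the observation and of the action of agent `i`;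
* `𝓦s`, `𝓦o`: values of the state noise and of the observation noise;
* `𝓜 i`: values of the local information of agent `i`; `𝓩`: values of the common observation.

Time is counted from `0`, so time `t` here is the `(t+1)`-st period. -/
structure PHSSystem (ι : Type u₁) (𝓧 : Type u₂) (𝓨 : ι → Type u₃) (𝓤 : ι → Type u₄)
    (𝓦s : Type u₅) (𝓦o : Type u₆) (𝓜 : ι → Type u₇) (𝓩 : Type u₈) where
  /-- dynamics `X_{t+1} = f(X_t, U_t, W^s_t)` -/
  f : 𝓧 → (∀ i, 𝓤 i) → 𝓦s → 𝓧
  /-- observations `Y_t = h(X_t, U_{t-1}, W^o_t)` -/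
  h : 𝓧 → (∀ i, 𝓤 i) → 𝓦o → (∀ i, 𝓨 i)
  /-- the fixed value that stands for the action "before" the first period in the first
  observation -/
  u₀ : ∀ i, 𝓤 i
  /-- law of the initial state -/
  PX : PMF 𝓧
  /-- law of the state noise -/
  PWs : PMF 𝓦s
  /-- law of the observation noise -/
  PWo : PMF 𝓦o
  /-- per-step cost -/
  cost : 𝓧 → (∀ i, 𝓤 i) → ℝ
  /-- discount factor -/
  β : ℝ
  β_pos : 0 < β
  β_lt_one : β < 1
  /-- the part of the first observation that agent `i` keeps as local information -/
  m₀ : ∀ i, 𝓨 i → 𝓜 i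
  /-- the part of `(M^i_t, U^i_t, Y^i_{t+1})` that agent `i` keeps as `M^i_{t+1}` -/
  ξ : ∀ i, 𝓜 i → 𝓤 i → 𝓨 i → 𝓜 i
  /-- the part `Z_t` of `(M_t, U_t, Y_{t+1})` that becomes known to all agents at time `t+1` -/
  ζ : (∀ i, 𝓜 i) → (∀ i, 𝓤 i) → (∀ i, 𝓨 i) → 𝓩

namespace PHSSystem

variable {ι : Type u₁} {𝓧 : Type u₂} {𝓨 : ι → Type u₃} {𝓤 : ι → Type u₄}
  {𝓦s : Type u₅} {𝓦o : Type u₆} {𝓜 : ι → Type u₇} {𝓩 : Type u₈}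

/-! ### The decentralized system and the coordinated system -/

/-- The primitive random variables on a common probability space: the initial state and the two
i.i.d. noise processes, all mutually independent, with the laws prescribed by the system. -/
structure Primitives (Sys : PHSSystem ι 𝓧 𝓨 𝓤 𝓦s 𝓦o 𝓜 𝓩) {Ω : Type u₉} [MeasurableSpace Ω]
    (P : Measure Ω) where
  X₁ : Ω → 𝓧
  Ws : ℕ → Ω → 𝓦s
  Wo : ℕ → Ω → 𝓦o
  measurable_X₁ : Measurable[_, ⊤] X₁
  measurable_Ws : ∀ t, Measurable[_, ⊤] (Ws t)
  measurable_Wo : ∀ t, Measurable[_, ⊤] (Wo t)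
  law_X₁ : ∀ x, P (X₁ ⁻¹' {x}) = Sys.PX x
  law_Ws : ∀ t w, P (Ws t ⁻¹' {w}) = Sys.PWs w
  law_Wo : ∀ t w, P (Wo t ⁻¹' {w}) = Sys.PWo w
  indep : iIndep (fun k : Unit ⊕ ℕ ⊕ ℕ =>
    Sum.elim (fun _ => MeasurableSpace.comap X₁ ⊤)
      (Sum.elim (fun t => MeasurableSpace.comap (Ws t) ⊤)
        (fun t => MeasurableSpace.comap (Wo t) ⊤)) k) P

/-- What there is at time `t`: the state `X_t`, the joint local information `M_t`, and the common
information `C_t`, which is the list `[Z_0, …, Z_{t-1}]` of the past common observations. -/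
structure Snapshot (𝓧 : Type u₂) (𝓜 : ι → Type u₇) (𝓩 : Type u₈) where
  x : 𝓧
  m : ∀ i, 𝓜 i
  c : List 𝓩

/-- The evolution of the system when the joint action at each time is the function `act` of the
common and the local information, `U_t = act C_t M_t` (the time `t` is the length of `C_t`). -/
def traj (Sys : PHSSystem ι 𝓧 𝓨 𝓤 𝓦s 𝓦o 𝓜 𝓩) {Ω : Type u₉} [MeasurableSpace Ω]
    {P : Measure Ω} (prim : Sys.Primitives P)
    (act : List 𝓩 → (∀ i, 𝓜 i) → (∀ i, 𝓤 i)) : ℕ → Ω → Snapshot 𝓧 𝓜 𝓩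
  | 0, ω =>
    let x := prim.X₁ ω
    let y := Sys.h x Sys.u₀ (prim.Wo 0 ω)
    { x := x
      m := fun i => Sys.m₀ i (y i)
      c := [] }
  | t + 1, ω =>
    let q := traj Sys prim act t ω
    let u := act q.c q.m
    let x' := Sys.f q.x u (prim.Ws t ω)
    let y' := Sys.h x' u (prim.Wo (t + 1) ω)
    { x := x'
      m := fun i => Sys.ξ i (q.m i) (u i) (y' i)
      c := q.c ++ [Sys.ζ q.m u y'] }

/-- Expected discounted cost when `U_t = act C_t M_t`. -/
def totalCost (Sys : PHSSystem ι 𝓧 𝓨 𝓤 𝓦s 𝓦o 𝓜 𝓩) {Ω : Type u₉} [MeasurableSpace Ω]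
    {P : Measure Ω} (prim : Sys.Primitives P)
    (act : List 𝓩 → (∀ i, 𝓜 i) → (∀ i, 𝓤 i)) : ℝ :=
  ∫ ω, ∑' t : ℕ, Sys.β ^ t *
    Sys.cost (Sys.traj prim act t ω).x
      (act (Sys.traj prim act t ω).c (Sys.traj prim act t ω).m) ∂P

/-- Joint (decentralized) strategies: agent `i` chooses `U^i_t = g^i_t(I^i_t)` with
`I^i_t = (C_t, M^i_t)`. The time `t` is the length of the list `C_t`. -/
abbrev Strategy (𝓤 : ι → Type u₄) (𝓜 : ι → Type u₇) (𝓩 : Type u₈) :=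
  ∀ i, List 𝓩 → 𝓜 i → 𝓤 i

/-- The cost `J(g)` of a joint strategy. -/
def J (Sys : PHSSystem ι 𝓧 𝓨 𝓤 𝓦s 𝓦o 𝓜 𝓩) {Ω : Type u₉} [MeasurableSpace Ω]
    {P : Measure Ω} (prim : Sys.Primitives P) (g : Strategy 𝓤 𝓜 𝓩) : ℝ :=
  Sys.totalCost prim (fun c m i => g i c (m i))

/-- `g` is an optimal joint strategy of the decentralized system. -/
def IsOptimal (Sys : PHSSystem ι 𝓧 𝓨 𝓤 𝓦s 𝓦o 𝓜 𝓩) {Ω : Type u₉} [MeasurableSpace Ω]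
    {P : Measure Ω} (prim : Sys.Primitives P) (g : Strategy 𝓤 𝓜 𝓩) : Prop :=
  ∀ g' : Strategy 𝓤 𝓜 𝓩, Sys.J prim g ≤ Sys.J prim g'

/-- Prescriptions: for each agent a map from local information to actions. -/
abbrev Prescription (𝓤 : ι → Type u₄) (𝓜 : ι → Type u₇) := ∀ i, 𝓜 i → 𝓤 i

/-- Coordination strategies `Γ_t = ψ_t(C_t)`. The time `t` is the length of the list `C_t`. -/
abbrev CoordStrategy (𝓤 : ι → Type u₄) (𝓜 : ι → Type u₇) (𝓩 : Type u₈) :=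
  List 𝓩 → Prescription 𝓤 𝓜

/-- The cost `J(ψ)` of a coordination strategy, where `U^i_t = Γ^i_t(M^i_t)`. -/
def coordJ (Sys : PHSSystem ι 𝓧 𝓨 𝓤 𝓦s 𝓦o 𝓜 𝓩) {Ω : Type u₉} [MeasurableSpace Ω]
    {P : Measure Ω} (prim : Sys.Primitives P) (ψ : CoordStrategy 𝓤 𝓜 𝓩) : ℝ :=
  Sys.totalCost prim (fun c m i => ψ c i (m i))

/-- `ψ` is an optimal strategy of the coordinated system. -/
def IsCoordOptimal (Sys : PHSSystem ι 𝓧 𝓨 𝓤 𝓦s 𝓦o 𝓜 𝓩) {Ω : Type u₉} [MeasurableSpace Ω]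
    {P : Measure Ω} (prim : Sys.Primitives P) (ψ : CoordStrategy 𝓤 𝓜 𝓩) : Prop :=
  ∀ ψ' : CoordStrategy 𝓤 𝓜 𝓩, Sys.coordJ prim ψ ≤ Sys.coordJ prim ψ'

/-! ### The information state -/

/-- Information states: probability distributions of `(X_t, M_t)`. -/
abbrev Belief (𝓧 : Type u₂) (𝓜 : ι → Type u₇) := PMF (𝓧 × (∀ i, 𝓜 i))

/-- The law of `(X_1, M_1)`. -/
def initBelief (Sys : PHSSystem ι 𝓧 𝓨 𝓤 𝓦s 𝓦o 𝓜 𝓩) : Belief 𝓧 𝓜 :=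
  Sys.PX.bind fun x => Sys.PWo.map fun w => (x, fun i => Sys.m₀ i (Sys.h x Sys.u₀ w i))

/-- The law of `((X_{t+1}, M_{t+1}), Z_t)` given `X_t = x`, `M_t = m`, `Γ_t = γ`. -/
def transLaw (Sys : PHSSystem ι 𝓧 𝓨 𝓤 𝓦s 𝓦o 𝓜 𝓩) (γ : Prescription 𝓤 𝓜)
    (xm : 𝓧 × (∀ i, 𝓜 i)) : PMF ((𝓧 × (∀ i, 𝓜 i)) × 𝓩) :=
  let u : ∀ i, 𝓤 i := fun i => γ i (xm.2 i)
  Sys.PWs.bind fun ws => Sys.PWo.map fun wo =>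
    let x' := Sys.f xm.1 u ws
    let y' := Sys.h x' u wo
    ((x', fun i => Sys.ξ i (xm.2 i) (u i) (y' i)), Sys.ζ xm.2 u y')

/-- The law of `((X_{t+1}, M_{t+1}), Z_t)` given `Π_t = π` and `Γ_t = γ`. -/
def jointLaw (Sys : PHSSystem ι 𝓧 𝓨 𝓤 𝓦s 𝓦o 𝓜 𝓩) (π : Belief 𝓧 𝓜)
    (γ : Prescription 𝓤 𝓜) : PMF ((𝓧 × (∀ i, 𝓜 i)) × 𝓩) :=
  π.bind (Sys.transLaw γ)

/-- The law of the common observation `Z_t` given `Π_t = π` and `Γ_t = γ`. -/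
def obsLaw (Sys : PHSSystem ι 𝓧 𝓨 𝓤 𝓦s 𝓦o 𝓜 𝓩) (π : Belief 𝓧 𝓜)
    (γ : Prescription 𝓤 𝓜) : PMF 𝓩 :=
  (Sys.jointLaw π γ).map Prod.snd

/-- The conditional expectation `ℓ̂(π, γ)` of the per-step cost given `Π_t = π` and `Γ_t = γ`. -/
def beliefCost (Sys : PHSSystem ι 𝓧 𝓨 𝓤 𝓦s 𝓦o 𝓜 𝓩) (π : Belief 𝓧 𝓜)
    (γ : Prescription 𝓤 𝓜) : ℝ :=
  ∑' xm : 𝓧 × (∀ i, 𝓜 i), (π xm).toReal * Sys.cost xm.1 (fun i => γ i (xm.2 i))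

open Classical in
/-- The update `π_{t+1} = φ(π_t, γ_t, z_t)` of the information state: the conditional law of
`(X_{t+1}, M_{t+1})` given `Z_t = z`, when `Π_t = π` and `Γ_t = γ`. Where `Z_t = z` has probability
zero the conditional law is not determined, and an arbitrary version `dflt` of it is used. -/
def φ (Sys : PHSSystem ι 𝓧 𝓨 𝓤 𝓦s 𝓦o 𝓜 𝓩)
    (dflt : Belief 𝓧 𝓜 → Prescription 𝓤 𝓜 → 𝓩 → Belief 𝓧 𝓜)
    (π : Belief 𝓧 𝓜) (γ : Prescription 𝓤 𝓜) (z : 𝓩) : Belief 𝓧 𝓜 :=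
  if hz : ∃ a ∈ {a : (𝓧 × (∀ i, 𝓜 i)) × 𝓩 | a.2 = z}, a ∈ (Sys.jointLaw π γ).support then
    ((Sys.jointLaw π γ).filter {a | a.2 = z} hz).map Prod.fst
  else dflt π γ z

/-- Membership in the reachable set `𝓡`: all information states that are generated from the
initial one by `φ`, with arbitrary prescriptions and common observations. -/
inductive Reachable (Sys : PHSSystem ι 𝓧 𝓨 𝓤 𝓦s 𝓦o 𝓜 𝓩)
    (dflt : Belief 𝓧 𝓜 → Prescription 𝓤 𝓜 → 𝓩 → Belief 𝓧 𝓜) : Belief 𝓧 𝓜 → Prop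
  | init : Reachable Sys dflt Sys.initBelief
  | step (π : Belief 𝓧 𝓜) (γ : Prescription 𝓤 𝓜) (z : 𝓩) :
      Reachable Sys dflt π → Reachable Sys dflt (Sys.φ dflt π γ z)

/-- The reachable set `𝓡`. -/
abbrev ReachSet (Sys : PHSSystem ι 𝓧 𝓨 𝓤 𝓦s 𝓦o 𝓜 𝓩)
    (dflt : Belief 𝓧 𝓜 → Prescription 𝓤 𝓜 → 𝓩 → Belief 𝓧 𝓜) :=
  {π : Belief 𝓧 𝓜 // Sys.Reachable dflt π}

/-- The initial information state, as a point of `𝓡`. -/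
def reachInit (Sys : PHSSystem ι 𝓧 𝓨 𝓤 𝓦s 𝓦o 𝓜 𝓩)
    (dflt : Belief 𝓧 𝓜 → Prescription 𝓤 𝓜 → 𝓩 → Belief 𝓧 𝓜) : Sys.ReachSet dflt :=
  ⟨Sys.initBelief, Reachable.init⟩

/-- The update `φ` on `𝓡`. -/
def reachStep (Sys : PHSSystem ι 𝓧 𝓨 𝓤 𝓦s 𝓦o 𝓜 𝓩)
    (dflt : Belief 𝓧 𝓜 → Prescription 𝓤 𝓜 → 𝓩 → Belief 𝓧 𝓜)
    (π : Sys.ReachSet dflt) (γ : Prescription 𝓤 𝓜) (z : 𝓩) : Sys.ReachSet dflt :=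
  ⟨Sys.φ dflt π.1 γ z, Reachable.step π.1 γ z π.2⟩

/-- The information state after the common observations `c = [z_0, …, z_{t-1}]` when the
prescriptions are `γ_k = ψ(π_k)`. -/
def beliefAt (Sys : PHSSystem ι 𝓧 𝓨 𝓤 𝓦s 𝓦o 𝓜 𝓩)
    (dflt : Belief 𝓧 𝓜 → Prescription 𝓤 𝓜 → 𝓩 → Belief 𝓧 𝓜)
    (ψ : Sys.ReachSet dflt → Prescription 𝓤 𝓜) (c : List 𝓩) : Sys.ReachSet dflt :=
  c.foldl (fun π z => Sys.reachStep dflt π (ψ π) z) (Sys.reachInit dflt)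

/-- The coordination strategy `Γ_t = ψ(Π_t)` given by a map `ψ` on `𝓡`. -/
def toCoord (Sys : PHSSystem ι 𝓧 𝓨 𝓤 𝓦s 𝓦o 𝓜 𝓩)
    (dflt : Belief 𝓧 𝓜 → Prescription 𝓤 𝓜 → 𝓩 → Belief 𝓧 𝓜)
    (ψ : Sys.ReachSet dflt → Prescription 𝓤 𝓜) : CoordStrategy 𝓤 𝓜 𝓩 :=
  fun c => ψ (Sys.beliefAt dflt ψ c)

/-- The joint strategy `U^i_t = ψ(Π_t)^i(M^i_t)` given by a map `ψ` on `𝓡`. -/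
def toStrategy (Sys : PHSSystem ι 𝓧 𝓨 𝓤 𝓦s 𝓦o 𝓜 𝓩)
    (dflt : Belief 𝓧 𝓜 → Prescription 𝓤 𝓜 → 𝓩 → Belief 𝓧 𝓜)
    (ψ : Sys.ReachSet dflt → Prescription 𝓤 𝓜) : Strategy 𝓤 𝓜 𝓩 :=
  fun i c mi => ψ (Sys.beliefAt dflt ψ c) i mi

/-! ### Incrementally expanding representations and the MDP `Δ` -/

/-- An incrementally expanding representation with state space `𝓢`; `level k` is the `(k+1)`-st
of the finite sets. -/
structure IER (Sys : PHSSystem ι 𝓧 𝓨 𝓤 𝓦s 𝓦o 𝓜 𝓩)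
    (dflt : Belief 𝓧 𝓜 → Prescription 𝓤 𝓜 → 𝓩 → Belief 𝓧 𝓜) (𝓢 : Type u₁₀) where
  level : ℕ → Set 𝓢
  finite_level : ∀ k, (level k).Finite
  strict : ∀ k, level k ⊂ level (k + 1)
  /-- the initial state `s*` -/
  sInit : 𝓢
  level_zero : level 0 = {sInit}
  iUnion_level : ⋃ k, level k = Set.univ
  B : 𝓢 → Sys.ReachSet dflt
  surjective_B : Function.Surjective B
  /-- the dynamics `f̃` -/
  next : 𝓢 → Prescription 𝓤 𝓜 → 𝓩 → 𝓢
  /-- incremental expansion -/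
  expansion : ∀ k, ∀ s ∈ level k, ∀ γ z, next s γ z ∈ level (k + 1)
  /-- consistency: the states generated from `π_1` and from `s*` by the same prescriptions and
  common observations correspond to each other under `B` -/
  consistent : ∀ hist : List (Prescription 𝓤 𝓜 × 𝓩),
    hist.foldl (fun π a => Sys.reachStep dflt π a.1 a.2) (Sys.reachInit dflt) =
      B (hist.foldl (fun s a => next s a.1 a.2) sInit)

variable {Sys : PHSSystem ι 𝓧 𝓨 𝓤 𝓦s 𝓦o 𝓜 𝓩}
  {dflt : Belief 𝓧 𝓜 → Prescription 𝓤 𝓜 → 𝓩 → Belief 𝓧 𝓜} {𝓢 : Type u₁₀}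

/-- The law of the state `S_t` of `Δ` under a stationary strategy: `S_0 = s*` and
`S_{t+1} = f̃(S_t, Γ_t, Z_t)`, where `Γ_t = ψ(S_t)` and, given `S_t = s` and `Γ_t = γ`, the common
observation `Z_t` has the law that it has given `Π_t = B(s)` and `Γ_t = γ`. -/
def IER.stateLaw (R : IER Sys dflt 𝓢) (ψ : 𝓢 → Prescription 𝓤 𝓜) : ℕ → PMF 𝓢
  | 0 => PMF.pure R.sInit
  | t + 1 => (R.stateLaw ψ t).bind fun s =>
      (Sys.obsLaw (R.B s).1 (ψ s)).map (R.next s (ψ s))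

/-- The per-step cost `ℓ̃(s, γ) = ℓ̂(B(s), γ)` of `Δ`. -/
def IER.cost (R : IER Sys dflt 𝓢) (s : 𝓢) (γ : Prescription 𝓤 𝓜) : ℝ :=
  Sys.beliefCost (R.B s).1 γ

/-- The expected discounted cost `J̃(ψ)` of a stationary strategy of `Δ`. -/
def IER.J (R : IER Sys dflt 𝓢) (ψ : 𝓢 → Prescription 𝓤 𝓜) : ℝ :=
  ∑' t : ℕ, Sys.β ^ t * ∑' s : 𝓢, (R.stateLaw ψ t s).toReal * R.cost s (ψ s)

/-- `ψ` is an optimal (stationary) strategy of `Δ`. -/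
def IER.IsOptimal (R : IER Sys dflt 𝓢) (ψ : 𝓢 → Prescription 𝓤 𝓜) : Prop :=
  ∀ ψ' : 𝓢 → Prescription 𝓤 𝓜, R.J ψ ≤ R.J ψ'

end PHSSystem

end

/-! Dynamic programming on the reachable set. The Bellman equation on `𝓡` has a bounded solution
`V`, and since there are finitely many prescriptions its minimum is attained at every `π`. Both the
MDP `Δ` and the coordinated system are instances of one kind of process (`chainLaw`): a state `s`
carries an information state `b s` and a prescription `a s`, and moves with the observation, which
has the law prescribed by `(b s, a s)`. In `Δ` the process is `S_t` with `b = B`; in the coordinated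
system it is the pair of information state and common information, so history-dependent strategies
are covered.

If `b` follows the update `φ` at visited states, telescoping the Bellman equation gives cost = `V`
at the start + discounted sum of expected Bellman gaps (`chainCost_eq`). The gaps are nonnegative.
Hence `V(π_1)` bounds every cost from below, and it is attained exactly when every prescription used
at a state of positive probability is a Bellman minimizer. An optimal strategy of `Δ` attains
`V(π_1)`, because a Bellman-greedy one does; so it is greedy at all visited states.

For the second claim, two visited states in one fibre of `B` may carry different prescriptions, but
both are minimizers at the common information state, so either may be selected. Unvisited states
carry no such guarantee, so a visited representative is chosen whenever the fibre has one. An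
induction shows that the resulting strategy only meets images of visited states, hence is greedy
along its own path.

It remains to identify the cost on `Ω` with that of the chain: the trajectory has the expected law
by independence of the primitives, and the information state is the conditional law of state and
local information given the common information (`snapLaw_eq_bind`). -/

/-- The expectation of `f` under `p`. -/
noncomputable def pmfExp {α : Type*} (p : PMF α) (f : α → ℝ) : ℝ := ∑' a, (p a).toReal * f a

/-! ### Expectations of bounded functions under a discrete law -/

namespace pmfExp

variable {α β : Type*}

theorem hasSum_toReal (p : PMF α) : HasSum (fun a => (p a).toReal) 1 := by
  have h := ENNReal.hasSum_toReal p.tsum_coe_ne_top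
  rwa [← ENNReal.tsum_toReal_eq p.apply_ne_top, p.tsum_coe, ENNReal.toReal_one] at h

theorem summable (p : PMF α) {f : α → ℝ} {C : ℝ} (hf : ∀ a, |f a| ≤ C) :
    Summable fun a => (p a).toReal * f a := by
  refine Summable.of_norm_bounded ((hasSum_toReal p).summable.mul_right C) fun a => ?_
  rw [Real.norm_eq_abs, abs_mul, abs_of_nonneg ENNReal.toReal_nonneg]
  exact mul_le_mul_of_nonneg_left (hf a) ENNReal.toReal_nonneg

theorem congr_support {p : PMF α} {f g : α → ℝ} (h : ∀ a ∈ p.support, f a = g a) :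
    pmfExp p f = pmfExp p g := by
  refine tsum_congr fun a => ?_
  by_cases ha : p a = 0
  · simp [ha]
  · rw [h a ((p.mem_support_iff a).2 ha)]

theorem add (p : PMF α) {f g : α → ℝ} {C D : ℝ} (hf : ∀ a, |f a| ≤ C) (hg : ∀ a, |g a| ≤ D) :
    pmfExp p (fun a => f a + g a) = pmfExp p f + pmfExp p g := by
  simp only [pmfExp, mul_add]
  exact (summable p hf).tsum_add (summable p hg)

theorem sub (p : PMF α) {f g : α → ℝ} {C D : ℝ} (hf : ∀ a, |f a| ≤ C) (hg : ∀ a, |g a| ≤ D) :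
    pmfExp p (fun a => f a - g a) = pmfExp p f - pmfExp p g := by
  simp only [pmfExp, mul_sub]
  exact (summable p hf).tsum_sub (summable p hg)

theorem const_mul (p : PMF α) (c : ℝ) (f : α → ℝ) :
    pmfExp p (fun a => c * f a) = c * pmfExp p f := by
  simp only [pmfExp, mul_left_comm _ c, tsum_mul_left]

theorem nonneg {p : PMF α} {f : α → ℝ} (hf : ∀ a, 0 ≤ f a) : 0 ≤ pmfExp p f :=
  tsum_nonneg fun a => mul_nonneg ENNReal.toReal_nonneg (hf a)

theorem abs_le (p : PMF α) {f : α → ℝ} {C : ℝ} (hf : ∀ a, |f a| ≤ C) : |pmfExp p f| ≤ C := by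
  have h := tsum_of_norm_bounded ((hasSum_toReal p).mul_right C)
    (f := fun a => (p a).toReal * f a) fun a => by
      rw [Real.norm_eq_abs, abs_mul, abs_of_nonneg ENNReal.toReal_nonneg]
      exact mul_le_mul_of_nonneg_left (hf a) ENNReal.toReal_nonneg
  simpa [pmfExp] using h

/-- Boundedness makes the series summable; without it a vanishing `tsum` would say nothing about the
terms. -/
theorem eq_zero_on_support {p : PMF α} {f : α → ℝ} {C : ℝ} (hf : ∀ a, |f a| ≤ C)
    (h0 : ∀ a, 0 ≤ f a) (h : pmfExp p f = 0) : ∀ a ∈ p.support, f a = 0 := by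
  intro a ha
  have hs := (summable p hf).hasSum
  rw [show ∑' a, (p a).toReal * f a = 0 from h,
    hasSum_zero_iff_of_nonneg fun a => mul_nonneg ENNReal.toReal_nonneg (h0 a)] at hs
  have := congrFun hs a
  simp only [Pi.zero_apply, mul_eq_zero] at this
  refine this.resolve_left fun h' => ?_
  rcases (ENNReal.toReal_eq_zero_iff _).1 h' with h' | h'
  · exact (p.mem_support_iff a).1 ha h'
  · exact p.apply_ne_top a h'

theorem pure (a : α) (f : α → ℝ) : pmfExp (PMF.pure a) f = f a := by
  rw [pmfExp, tsum_eq_single a]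
  · simp
  · intro b hb
    simp [PMF.pure_apply, hb]

/-- The tower property: an exchange of summation in an absolutely convergent double series. -/
theorem bind (p : PMF α) (k : α → PMF β) {f : β → ℝ} {C : ℝ} (hf : ∀ b, |f b| ≤ C) :
    pmfExp (p.bind k) f = pmfExp p fun a => pmfExp (k a) f := by
  have hk : ∀ b, ((p.bind k) b).toReal = ∑' a, (p a).toReal * ((k a) b).toReal := by
    intro b
    rw [PMF.bind_apply, ENNReal.tsum_toReal_eq fun a =>
      ENNReal.mul_ne_top (p.apply_ne_top a) ((k a).apply_ne_top b)]
    simp only [ENNReal.toReal_mul]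
  have hsum : Summable fun x : α × β =>
      (p x.1).toReal * (((k x.1) x.2).toReal * f x.2) := by
    have hdom : Summable fun x : α × β =>
        (p x.1).toReal * (((k x.1) x.2).toReal * |C|) := by
      refine (summable_prod_of_nonneg fun x => ?_).2 ⟨fun a => ?_, ?_⟩
      · exact mul_nonneg ENNReal.toReal_nonneg
          (mul_nonneg ENNReal.toReal_nonneg (abs_nonneg C))
      · exact ((hasSum_toReal (k a)).summable.mul_right |C|).mul_left (p a).toReal
      · have h (a : α) : ∑' b, (p a).toReal * (((k a) b).toReal * |C|) =
            (p a).toReal * |C| := by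
          rw [tsum_mul_left, tsum_mul_right, (hasSum_toReal (k a)).tsum_eq, one_mul]
        simp only [h]
        exact (hasSum_toReal p).summable.mul_right |C|
    refine Summable.of_norm_bounded hdom fun x => ?_
    rw [Real.norm_eq_abs, abs_mul, abs_mul, abs_of_nonneg ENNReal.toReal_nonneg,
      abs_of_nonneg ENNReal.toReal_nonneg]
    exact mul_le_mul_of_nonneg_left (mul_le_mul_of_nonneg_left ((hf x.2).trans (le_abs_self C))
      ENNReal.toReal_nonneg) ENNReal.toReal_nonneg
  calc pmfExp (p.bind k) f
      = ∑' b, ∑' a, (p a).toReal * (((k a) b).toReal * f b) := by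
        refine tsum_congr fun b => ?_
        rw [hk, ← tsum_mul_right]
        simp only [mul_assoc]
    _ = ∑' a, ∑' b, (p a).toReal * (((k a) b).toReal * f b) :=
        (Summable.tsum_comm (f := fun a b => (p a).toReal * (((k a) b).toReal * f b)) hsum)
    _ = _ := by simp only [pmfExp, tsum_mul_left]

theorem map (p : PMF α) (g : α → β) {f : β → ℝ} {C : ℝ} (hf : ∀ b, |f b| ≤ C) :
    pmfExp (p.map g) f = pmfExp p fun a => f (g a) := by
  rw [← PMF.bind_pure_comp, bind p _ hf]
  simp only [Function.comp_apply, pure]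

end pmfExp

/-- Banach's fixed point theorem on bounded real functions. -/
theorem exists_bounded_fixedPoint {α : Type*} {β : ℝ} (hβ0 : 0 ≤ β) (hβ : β < 1)
    (T : (α → ℝ) → α → ℝ)
    (hb : ∀ V : α → ℝ, (∃ C, ∀ a, |V a| ≤ C) → ∃ C, ∀ a, |T V a| ≤ C)
    (hc : ∀ (V W : α → ℝ) (C : ℝ), (∃ C, ∀ a, |V a| ≤ C) → (∃ C, ∀ a, |W a| ≤ C) →
      (∀ a, |V a - W a| ≤ C) → ∀ a, |T V a - T W a| ≤ β * C) :
    ∃ V : α → ℝ, (∃ C, ∀ a, |V a| ≤ C) ∧ T V = V := by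
  -- For the discrete topology every bounded function is continuous, so the complete space of
  -- bounded continuous functions is available.
  let _ : TopologicalSpace α := ⊥
  have _ : DiscreteTopology α := ⟨rfl⟩
  have hbd : ∀ V : BoundedContinuousFunction α ℝ, ∃ C, ∀ a, |V a| ≤ C :=
    fun V => ⟨‖V‖, fun a => V.norm_coe_le_norm a⟩
  choose C hC using fun V : BoundedContinuousFunction α ℝ => hb V (hbd V)
  let F : BoundedContinuousFunction α ℝ → BoundedContinuousFunction α ℝ := fun V =>
    BoundedContinuousFunction.ofNormedAddCommGroupDiscrete (T V) (C V) (hC V)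
  have hF : ContractingWith ⟨β, hβ0⟩ F := by
    refine ⟨by exact_mod_cast hβ, LipschitzWith.of_dist_le_mul fun V W => ?_⟩
    refine (BoundedContinuousFunction.dist_le (mul_nonneg hβ0 dist_nonneg)).2 fun a => ?_
    exact hc V W (dist V W) (hbd V) (hbd W)
      (fun a => (Real.dist_eq (V a) (W a)).symm.trans_le
        (BoundedContinuousFunction.dist_coe_le_dist a)) a
  exact ⟨hF.fixedPoint, hbd _, congrArg DFunLike.coe hF.fixedPoint_isFixedPt⟩

noncomputable section
universe u₁ u₂ u₃ u₄ u₅ u₆ u₇ u₈ u₉ u₁₀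
namespace PHSSystem

variable {ι : Type u₁} {𝓧 : Type u₂} {𝓨 : ι → Type u₃} {𝓤 : ι → Type u₄}
  {𝓦s : Type u₅} {𝓦o : Type u₆} {𝓜 : ι → Type u₇} {𝓩 : Type u₈}
  (Sys : PHSSystem ι 𝓧 𝓨 𝓤 𝓦s 𝓦o 𝓜 𝓩)
  (dflt : Belief 𝓧 𝓜 → Prescription 𝓤 𝓜 → 𝓩 → Belief 𝓧 𝓜)

theorem exists_cost_bound [Finite ι] [Finite 𝓧] [∀ i, Finite (𝓤 i)] :
    ∃ C, ∀ x u, |Sys.cost x u| ≤ C := by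
  obtain ⟨C, hC⟩ := (Set.finite_range fun p : 𝓧 × (∀ i, 𝓤 i) => |Sys.cost p.1 p.2|).bddAbove
  exact ⟨C, fun x u => hC ⟨(x, u), rfl⟩⟩

theorem abs_beliefCost_le {C : ℝ} (hC : ∀ x u, |Sys.cost x u| ≤ C) (π : Belief 𝓧 𝓜)
    (γ : Prescription 𝓤 𝓜) : |Sys.beliefCost π γ| ≤ C :=
  pmfExp.abs_le π fun _ => hC _ _

/-! ### The Bellman equation on the reachable set -/

/-- The cost of using `γ` at `π` for one period when the cost to go afterwards is `V`. -/
def stateActionValue (V : Sys.ReachSet dflt → ℝ) (π : Sys.ReachSet dflt)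
    (γ : Prescription 𝓤 𝓜) : ℝ :=
  Sys.beliefCost π.1 γ +
    Sys.β * pmfExp (Sys.obsLaw π.1 γ) fun z => V (Sys.reachStep dflt π γ z)

/-- A bounded solution of the Bellman equation. -/
structure IsBellmanSolution (V : Sys.ReachSet dflt → ℝ) : Prop where
  bounded : ∃ C, ∀ π, |V π| ≤ C
  le : ∀ π γ, V π ≤ Sys.stateActionValue dflt V π γ
  attained : ∀ π, ∃ γ, Sys.stateActionValue dflt V π γ = V π

variable {Sys dflt} in
theorem abs_stateActionValue_le {C D : ℝ} (hC : ∀ x u, |Sys.cost x u| ≤ C)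
    {V : Sys.ReachSet dflt → ℝ} (hV : ∀ π, |V π| ≤ D) (π : Sys.ReachSet dflt)
    (γ : Prescription 𝓤 𝓜) : |Sys.stateActionValue dflt V π γ| ≤ C + Sys.β * D := by
  refine (abs_add_le _ _).trans (add_le_add (Sys.abs_beliefCost_le hC _ _) ?_)
  rw [abs_mul, abs_of_pos Sys.β_pos]
  exact mul_le_mul_of_nonneg_left (pmfExp.abs_le _ fun _ => hV _) Sys.β_pos.le

/-- The Bellman operator is a `β`-contraction in the supremum norm. Finiteness of the set of
prescriptions turns its infimum into an attained minimum. -/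
theorem exists_isBellmanSolution [Finite ι] [Finite 𝓧] [∀ i, Finite (𝓤 i)]
    [∀ i, Finite (𝓜 i)] : ∃ V, Sys.IsBellmanSolution dflt V := by
  obtain ⟨C, hC⟩ := Sys.exists_cost_bound
  have : Nonempty (Prescription 𝓤 𝓜) := ⟨fun i _ => Sys.u₀ i⟩
  have hbdd (V : Sys.ReachSet dflt → ℝ) (π) :
      BddBelow (Set.range (Sys.stateActionValue dflt V π)) := (Set.finite_range _).bddBelow
  have hatt (V : Sys.ReachSet dflt → ℝ) (π) :=
    exists_eq_ciInf_of_finite (f := Sys.stateActionValue dflt V π)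
  suffices h : ∃ V : Sys.ReachSet dflt → ℝ, (∃ D, ∀ π, |V π| ≤ D) ∧
      (fun π => ⨅ γ, Sys.stateActionValue dflt V π γ) = V by
    obtain ⟨V, hV, hfix⟩ := h
    refine ⟨V, hV, fun π γ => ?_, fun π => ?_⟩
    · exact (congrFun hfix π).symm.trans_le (ciInf_le (hbdd V π) γ)
    · obtain ⟨γ, hγ⟩ := hatt V π
      exact ⟨γ, hγ.trans (congrFun hfix π)⟩
  refine exists_bounded_fixedPoint Sys.β_pos.le Sys.β_lt_one
    (fun V π => ⨅ γ, Sys.stateActionValue dflt V π γ) ?_ ?_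
  · rintro V ⟨D, hD⟩
    refine ⟨C + Sys.β * D, fun π => ?_⟩
    obtain ⟨γ, hγ⟩ := hatt V π
    exact hγ ▸ abs_stateActionValue_le hC hD π γ
  · rintro V W K ⟨D, hD⟩ ⟨D', hD'⟩ hVW π
    have key : ∀ γ, |Sys.stateActionValue dflt V π γ - Sys.stateActionValue dflt W π γ| ≤
        Sys.β * K := by
      intro γ
      rw [stateActionValue, stateActionValue, add_sub_add_left_eq_sub, ← mul_sub,
        ← pmfExp.sub _ (fun _ => hD _) (fun _ => hD' _), abs_mul, abs_of_pos Sys.β_pos]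
      exact mul_le_mul_of_nonneg_left (pmfExp.abs_le _ fun _ => hVW _) Sys.β_pos.le
    -- Each infimum is tested at the minimizer of the other, which bounds the difference from both
    -- sides.
    obtain ⟨γ, hγ⟩ := hatt V π
    obtain ⟨γ', hγ'⟩ := hatt W π
    have h1 := ciInf_le (hbdd V π) γ'
    have h2 := ciInf_le (hbdd W π) γ
    have h3 := abs_le.1 (key γ)
    have h4 := abs_le.1 (key γ')
    rw [abs_le]
    constructor <;> linarith

/-! ### Processes driven by the common observations -/

variable {T : Type*} (b : T → Sys.ReachSet dflt) (a : T → Prescription 𝓤 𝓜)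
  (next : T → 𝓩 → T) (s₀ : T)

/-- The law at time `t` of the process that starts in `s₀` and moves from `s` to `next s z`, where
the common observation `z` has the law that it has given the information state `b s` and the
prescription `a s`. -/
def chainLaw : ℕ → PMF T
  | 0 => PMF.pure s₀
  | t + 1 => (chainLaw t).bind fun s => (Sys.obsLaw (b s).1 (a s)).map (next s)

/-- The expected discounted cost along `chainLaw`. -/
def chainCost : ℝ :=
  ∑' t : ℕ, Sys.β ^ t *
    pmfExp (Sys.chainLaw dflt b a next s₀ t) fun s => Sys.beliefCost (b s).1 (a s)

variable {Sys dflt b a next s₀}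

theorem mem_support_chainLaw_zero {s : T} :
    s ∈ (Sys.chainLaw dflt b a next s₀ 0).support ↔ s = s₀ := by
  simp [chainLaw]

theorem mem_support_chainLaw_succ {t : ℕ} {s' : T} :
    s' ∈ (Sys.chainLaw dflt b a next s₀ (t + 1)).support ↔
      ∃ s ∈ (Sys.chainLaw dflt b a next s₀ t).support,
        ∃ z ∈ (Sys.obsLaw (b s).1 (a s)).support, next s z = s' := by
  simp only [chainLaw, PMF.mem_support_bind_iff, PMF.mem_support_map_iff]

theorem summable_discounted {v : ℕ → ℝ} {C : ℝ} (hv : ∀ t, |v t| ≤ C) :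
    Summable fun t => Sys.β ^ t * v t := by
  refine Summable.of_norm_bounded
    ((summable_geometric_of_lt_one Sys.β_pos.le Sys.β_lt_one).mul_right C) fun t => ?_
  rw [Real.norm_eq_abs, abs_mul, abs_of_pos (pow_pos Sys.β_pos t)]
  exact mul_le_mul_of_nonneg_left (hv t) (pow_pos Sys.β_pos t).le

variable [Finite ι] [Finite 𝓧] [∀ i, Finite (𝓤 i)]

/-- The cost exceeds the value of the initial information state by the discounted sum of the
expected Bellman gaps. -/
theorem chainCost_eq {V : Sys.ReachSet dflt → ℝ} (hV : Sys.IsBellmanSolution dflt V)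
    (hb : ∀ t, ∀ s ∈ (Sys.chainLaw dflt b a next s₀ t).support, ∀ z,
      b (next s z) = Sys.reachStep dflt (b s) (a s) z) :
    Sys.chainCost dflt b a next s₀ = V (b s₀) +
      ∑' t : ℕ, Sys.β ^ t * pmfExp (Sys.chainLaw dflt b a next s₀ t) fun s =>
        Sys.stateActionValue dflt V (b s) (a s) - V (b s) := by
  obtain ⟨C, hC⟩ := Sys.exists_cost_bound
  obtain ⟨D, hD⟩ := hV.bounded
  set law := Sys.chainLaw dflt b a next s₀ with hlaw
  let v : ℕ → ℝ := fun t => pmfExp (law t) fun s => V (b s)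
  have hQ : ∀ s, |Sys.stateActionValue dflt V (b s) (a s)| ≤ C + Sys.β * D :=
    fun s => abs_stateActionValue_le hC hD _ _
  have hgap : ∀ s, |Sys.stateActionValue dflt V (b s) (a s) - V (b s)| ≤ C + Sys.β * D + D :=
    fun s => (abs_sub _ _).trans (add_le_add (hQ s) (hD _))
  have hv : Summable fun t => Sys.β ^ t * v t :=
    summable_discounted fun t => pmfExp.abs_le _ fun s => hD (b s)
  have hstep : ∀ t, v (t + 1) = pmfExp (law t) fun s =>
      pmfExp (Sys.obsLaw (b s).1 (a s)) fun z => V (Sys.reachStep dflt (b s) (a s) z) := by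
    intro t
    simp only [v, hlaw, chainLaw]
    rw [pmfExp.bind _ _ fun s => hD (b s)]
    refine pmfExp.congr_support fun s hs => ?_
    rw [pmfExp.map _ _ fun s => hD (b s)]
    simp only [hb t s hs]
  -- The expected cost of one period is the expected state-action value minus the discounted value
  -- of the next state; adding and subtracting the present value leaves a telescoping term and the
  -- Bellman gap.
  have hterm : ∀ t, Sys.β ^ t * pmfExp (law t) (fun s => Sys.beliefCost (b s).1 (a s)) =
      (Sys.β ^ t * v t - Sys.β ^ (t + 1) * v (t + 1)) +
        Sys.β ^ t * pmfExp (law t)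
          (fun s => Sys.stateActionValue dflt V (b s) (a s) - V (b s)) := by
    intro t
    have hQE : pmfExp (law t) (fun s => Sys.stateActionValue dflt V (b s) (a s)) =
        pmfExp (law t) (fun s => Sys.beliefCost (b s).1 (a s)) + Sys.β * v (t + 1) := by
      rw [hstep, ← pmfExp.const_mul]
      refine pmfExp.add (C := C) (D := Sys.β * D) _
        (fun s => Sys.abs_beliefCost_le hC _ _) fun s => ?_
      rw [abs_mul, abs_of_pos Sys.β_pos]
      exact mul_le_mul_of_nonneg_left (pmfExp.abs_le _ fun _ => hD _) Sys.β_pos.le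
    rw [pmfExp.sub _ hQ fun s => hD (b s), hQE]
    ring
  have hv0 : v 0 = V (b s₀) := pmfExp.pure _ _
  have htel : ∑' t, (Sys.β ^ t * v t - Sys.β ^ (t + 1) * v (t + 1)) = V (b s₀) := by
    have hv' : Summable fun t => Sys.β ^ (t + 1) * v (t + 1) := (summable_nat_add_iff 1).2 hv
    rw [hv.tsum_sub hv', hv.tsum_eq_zero_add]
    simp [hv0]
  rw [chainCost, tsum_congr hterm, Summable.tsum_add, htel]
  · exact hv.sub ((summable_nat_add_iff 1).2 hv)
  · exact summable_discounted fun t => pmfExp.abs_le _ hgap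

theorem value_le_chainCost {V : Sys.ReachSet dflt → ℝ} (hV : Sys.IsBellmanSolution dflt V)
    (hb : ∀ t, ∀ s ∈ (Sys.chainLaw dflt b a next s₀ t).support, ∀ z,
      b (next s z) = Sys.reachStep dflt (b s) (a s) z) :
    V (b s₀) ≤ Sys.chainCost dflt b a next s₀ := by
  rw [chainCost_eq hV hb, le_add_iff_nonneg_right]
  exact tsum_nonneg fun t => mul_nonneg (pow_pos Sys.β_pos t).le
    (pmfExp.nonneg fun s => sub_nonneg.2 (hV.le _ _))

/-- A process attains the value exactly if it only uses prescriptions that attain the minimum in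
the Bellman equation. -/
theorem chainCost_eq_value_iff {V : Sys.ReachSet dflt → ℝ} (hV : Sys.IsBellmanSolution dflt V)
    (hb : ∀ t, ∀ s ∈ (Sys.chainLaw dflt b a next s₀ t).support, ∀ z,
      b (next s z) = Sys.reachStep dflt (b s) (a s) z) :
    Sys.chainCost dflt b a next s₀ = V (b s₀) ↔
      ∀ t, ∀ s ∈ (Sys.chainLaw dflt b a next s₀ t).support,
        Sys.stateActionValue dflt V (b s) (a s) = V (b s) := by
  obtain ⟨C, hC⟩ := Sys.exists_cost_bound
  obtain ⟨D, hD⟩ := hV.bounded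
  have h0 : ∀ s, 0 ≤ Sys.stateActionValue dflt V (b s) (a s) - V (b s) :=
    fun s => sub_nonneg.2 (hV.le _ _)
  have hgap : ∀ s, |Sys.stateActionValue dflt V (b s) (a s) - V (b s)| ≤ C + Sys.β * D + D :=
    fun s => (abs_sub _ _).trans (add_le_add (abs_stateActionValue_le hC hD _ _) (hD _))
  rw [chainCost_eq hV hb, add_eq_left]
  constructor
  -- A vanishing sum of nonnegative terms vanishes termwise: first over the times, then over the
  -- support at each time.
  · intro h t s hs
    have hsum := (summable_discounted (Sys := Sys) fun t =>
      pmfExp.abs_le (Sys.chainLaw dflt b a next s₀ t) hgap).hasSum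
    rw [h, hasSum_zero_iff_of_nonneg fun t =>
      mul_nonneg (pow_pos Sys.β_pos t).le (pmfExp.nonneg h0)] at hsum
    have ht := (mul_eq_zero.1 (congrFun hsum t)).resolve_left (pow_pos Sys.β_pos t).ne'
    exact sub_eq_zero.1 (pmfExp.eq_zero_on_support hgap h0 ht s hs)
  · intro h
    have hz : ∀ t, pmfExp (Sys.chainLaw dflt b a next s₀ t) (fun s =>
        Sys.stateActionValue dflt V (b s) (a s) - V (b s)) = 0 := fun t =>
      (pmfExp.congr_support fun s hs => sub_eq_zero.2 (h t s hs)).trans (by simp [pmfExp])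
    simp [hz]

end PHSSystem
end

/-! ### Laws of functions of independent discrete random variables -/

noncomputable section
universe u₁ u₂ u₃ u₄ u₅ u₆ u₇ u₈ u₉ u₁₀

/-- Serves both the disintegration of the joint law and the law of the pair of independent noises.
-/
theorem PMF.bind_map_mk_apply {α β : Type*} (p : PMF β) (k : β → PMF α) (a : α) (b : β) :
    (p.bind fun b => (k b).map fun a => (a, b)) (a, b) = p b * k b a := by
  classical
  rw [PMF.bind_apply, tsum_eq_single b]
  · rw [PMF.map_apply, tsum_eq_single a]
    · simp
    · intro a' ha'
      simp [ha'.symm]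
  · intro b' hb'
    rw [PMF.map_apply]
    simp [hb'.symm]

/-- The law of a function of two discrete random variables whose joint law is a product. -/
theorem PMF.measure_preimage_singleton_of_joint {Ω A B C : Type*} [MeasurableSpace Ω]
    {P : Measure Ω} [Countable A] [Countable B] {X : Ω → A} {Y : Ω → B} {p : PMF A} {k : PMF B}
    (hm : ∀ a b, MeasurableSet (X ⁻¹' {a} ∩ Y ⁻¹' {b}))
    (h : ∀ a b, P (X ⁻¹' {a} ∩ Y ⁻¹' {b}) = p a * k b) (g : A → B → C) (c : C) :
    P ((fun ω => g (X ω) (Y ω)) ⁻¹' {c}) = (p.bind fun a => k.map (g a)) c := by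
  classical
  have hpre (x : A × B) : (fun ω => (X ω, Y ω)) ⁻¹' {x} = X ⁻¹' {x.1} ∩ Y ⁻¹' {x.2} := by
    ext ω
    simp [Prod.ext_iff]
  have hset : (fun ω => g (X ω) (Y ω)) ⁻¹' {c} =
      (fun ω => (X ω, Y ω)) ⁻¹' {x : A × B | g x.1 x.2 = c} := rfl
  rw [hset, ← tsum_measure_preimage_singleton (Set.to_countable _)
    fun x _ => hpre x ▸ hm x.1 x.2,
    tsum_subtype {x : A × B | g x.1 x.2 = c} fun x => P ((fun ω => (X ω, Y ω)) ⁻¹' {x}),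
    ENNReal.tsum_prod', PMF.bind_apply]
  refine tsum_congr fun a => ?_
  rw [PMF.map_apply, ← ENNReal.tsum_mul_left]
  refine tsum_congr fun b => ?_
  by_cases hg : g a b = c
  · simp [Set.indicator, hg, hpre, h]
  · simp [Set.indicator, hg, Ne.symm hg]

/-- By countability the preimage is a countable union of intersections of fibres, so nothing is
required of `g`. -/
theorem measurable_top_comp₂ {Ω A B C : Type*} [Countable A] [Countable B] {m : MeasurableSpace Ω}
    {X : Ω → A} {Y : Ω → B} (hX : Measurable[m, ⊤] X) (hY : Measurable[m, ⊤] Y)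
    (g : A → B → C) : Measurable[m, ⊤] fun ω => g (X ω) (Y ω) := by
  intro s _
  have hset : (fun ω => g (X ω) (Y ω)) ⁻¹' s =
      ⋃ x : {x : A × B // g x.1 x.2 ∈ s}, X ⁻¹' {x.1.1} ∩ Y ⁻¹' {x.1.2} := by
    ext ω
    simp only [Set.mem_preimage, Set.mem_iUnion, Set.mem_inter_iff, Set.mem_singleton_iff]
    constructor
    · exact fun h => ⟨⟨(X ω, Y ω), h⟩, rfl, rfl⟩
    · rintro ⟨⟨x, hx⟩, h1, h2⟩
      rwa [h1, h2]
  rw [hset]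
  exact MeasurableSet.iUnion fun x => (hX trivial).inter (hY trivial)

namespace PHSSystem

variable {ι : Type u₁} {𝓧 : Type u₂} {𝓨 : ι → Type u₃} {𝓤 : ι → Type u₄}
  {𝓦s : Type u₅} {𝓦o : Type u₆} {𝓜 : ι → Type u₇} {𝓩 : Type u₈}
  {Sys : PHSSystem ι 𝓧 𝓨 𝓤 𝓦s 𝓦o 𝓜 𝓩}
  {dflt : Belief 𝓧 𝓜 → Prescription 𝓤 𝓜 → 𝓩 → Belief 𝓧 𝓜}

/-! ### The information state is a conditional law -/

/-- The disintegration of the joint law along the common observation. -/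
theorem jointLaw_eq_bind (π : Belief 𝓧 𝓜) (γ : Prescription 𝓤 𝓜) :
    Sys.jointLaw π γ =
      (Sys.obsLaw π γ).bind fun z => (Sys.φ dflt π γ z).map fun xm => (xm, z) := by
  classical
  ext ⟨q, z⟩
  rw [PMF.bind_map_mk_apply]
  set p := Sys.jointLaw π γ with hp
  -- This is the normalizing constant of `PMF.filter`, which therefore cancels against the weight of
  -- `z`.
  have hobs : Sys.obsLaw π γ z = ∑' r, ({a : (𝓧 × (∀ i, 𝓜 i)) × 𝓩 | a.2 = z}.indicator p) r := by
    rw [obsLaw, PMF.map_apply]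
    refine tsum_congr fun r => ?_
    simp only [Set.indicator, Set.mem_ofPred_eq, eq_comm, hp]
  by_cases hz : ∃ a ∈ {a : (𝓧 × (∀ i, 𝓜 i)) × 𝓩 | a.2 = z}, a ∈ p.support
  · have hφ : Sys.φ dflt π γ z q = (p.filter {a | a.2 = z} hz) (q, z) := by
      rw [φ, dif_pos hz, PMF.map_apply, tsum_eq_single (q, z)]
      · simp [hp]
      · rintro ⟨q', z'⟩ hne
        by_cases hq : q = q'
        · subst hq
          have hz' : (q, z') ∉ {a : (𝓧 × (∀ i, 𝓜 i)) × 𝓩 | a.2 = z} := by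
            rintro rfl
            exact hne rfl
          rw [if_pos rfl, PMF.filter_apply_eq_zero_of_notMem hz hz']
        · simp [hq]
    have hne : Sys.obsLaw π γ z ≠ 0 := by
      obtain ⟨r, hr, hr'⟩ := hz
      rw [← PMF.mem_support_iff, obsLaw, PMF.mem_support_map_iff]
      exact ⟨r, hr', hr⟩
    rw [hφ, PMF.filter_apply, ← hobs, Set.indicator_of_mem (by simp), mul_left_comm,
      ENNReal.mul_inv_cancel hne (PMF.apply_ne_top _ _), mul_one]
  -- For an observation of probability zero both sides vanish, whatever version `dflt` is used.
  · have h0 : ∀ q', p (q', z) = 0 := fun q' => by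
      by_contra h
      exact hz ⟨(q', z), rfl, h⟩
    have : Sys.obsLaw π γ z = 0 := by
      rw [hobs, ENNReal.tsum_eq_zero]
      rintro ⟨q', z'⟩
      by_cases hz' : z' = z
      · subst hz'
        rw [Set.indicator_of_mem (by simp), h0]
      · rw [Set.indicator_of_notMem (by simpa using hz')]
    rw [h0, this, zero_mul]

/-! ### The law of the trajectory -/

variable (Sys) in
/-- The law of the state, the local and the common information at time `t` under a coordination
strategy. -/
def snapLaw (ψ : CoordStrategy 𝓤 𝓜 𝓩) : ℕ → PMF (Snapshot 𝓧 𝓜 𝓩)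
  | 0 => Sys.initBelief.map fun xm => ⟨xm.1, xm.2, []⟩
  | t + 1 => (snapLaw ψ t).bind fun q =>
      (Sys.transLaw (ψ q.c) (q.x, q.m)).map fun r => ⟨r.1.1, r.1.2, q.c ++ [r.2]⟩

variable (Sys dflt) in
/-- The law of the information state together with the common information under a coordination
strategy. -/
def coordLaw (ψ : CoordStrategy 𝓤 𝓜 𝓩) : ℕ → PMF (Sys.ReachSet dflt × List 𝓩) :=
  Sys.chainLaw dflt Prod.fst (fun s => ψ s.2)
    (fun s z => (Sys.reachStep dflt s.1 (ψ s.2) z, s.2 ++ [z])) (Sys.reachInit dflt, [])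

/-- Given the common information, the information state is the conditional law of the state and
the local information. -/
theorem snapLaw_eq_bind (ψ : CoordStrategy 𝓤 𝓜 𝓩) (t : ℕ) :
    Sys.snapLaw ψ t = (Sys.coordLaw dflt ψ t).bind fun s =>
      s.1.1.map fun xm => ⟨xm.1, xm.2, s.2⟩ := by
  induction t with
  | zero => simp [snapLaw, coordLaw, chainLaw, reachInit]
  | succ t ih =>
    simp only [coordLaw] at ih ⊢
    rw [snapLaw, ih, chainLaw, PMF.bind_bind, PMF.bind_bind]
    congr 1
    funext s
    rw [PMF.bind_map, PMF.bind_map]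
    -- One step of the induction is the disintegration of the joint law, pushed forward by appending
    -- the new observation to the common information.
    have h := jointLaw_eq_bind (Sys := Sys) (dflt := dflt) s.1.1 (ψ s.2)
    have h' := congrArg (PMF.map fun r : (𝓧 × (∀ i, 𝓜 i)) × 𝓩 =>
      (⟨r.1.1, r.1.2, s.2 ++ [r.2]⟩ : Snapshot 𝓧 𝓜 𝓩)) h
    rw [jointLaw, PMF.map_bind, PMF.map_bind] at h'
    simp only [PMF.map_comp] at h'
    exact h'

/-! ### From the probability space to the chain of information states -/

section Trajectory

variable {Ω : Type u₉} [MeasurableSpace Ω] {P : Measure Ω} (prim : Sys.Primitives P)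

instance [Finite ι] [Finite 𝓧] [Finite 𝓩] [∀ i, Finite (𝓜 i)] : Countable (Snapshot 𝓧 𝓜 𝓩) :=
  Function.Injective.countable
    (f := fun q : Snapshot 𝓧 𝓜 𝓩 => (q.x, q.m, q.c)) fun q q' h => by
      cases q
      cases q'
      simpa using h

/-- The σ-algebra of a primitive random variable. -/
abbrev Primitives.sigma : Unit ⊕ ℕ ⊕ ℕ → MeasurableSpace Ω :=
  fun k => Sum.elim (fun _ => MeasurableSpace.comap prim.X₁ ⊤)
    (Sum.elim (fun t => MeasurableSpace.comap (prim.Ws t) ⊤)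
      (fun t => MeasurableSpace.comap (prim.Wo t) ⊤)) k

theorem Primitives.sigma_le (k) : prim.sigma k ≤ ‹MeasurableSpace Ω› := by
  rcases k with _ | t | t
  · exact prim.measurable_X₁.comap_le
  · exact (prim.measurable_Ws t).comap_le
  · exact (prim.measurable_Wo t).comap_le

/-- The primitive random variables that determine the trajectory up to time `t`. -/
def past (t : ℕ) : Set (Unit ⊕ ℕ ⊕ ℕ) :=
  {k | Sum.elim (fun _ => True) (Sum.elim (fun s => s < t) fun s => s ≤ t) k}

/-- The σ-algebra of a set of primitive random variables. -/
abbrev Primitives.sigmaOf (S : Set (Unit ⊕ ℕ ⊕ ℕ)) : MeasurableSpace Ω := ⨆ k ∈ S, prim.sigma k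

theorem Primitives.sigmaOf_le (S) : prim.sigmaOf S ≤ ‹MeasurableSpace Ω› :=
  iSup₂_le fun k _ => prim.sigma_le k

theorem Primitives.sigmaOf_mono {S S' : Set (Unit ⊕ ℕ ⊕ ℕ)} (h : S ⊆ S') :
    prim.sigmaOf S ≤ prim.sigmaOf S' :=
  biSup_mono h

theorem Primitives.sigma_le_sigmaOf {S : Set (Unit ⊕ ℕ ⊕ ℕ)} {k} (h : k ∈ S) :
    prim.sigma k ≤ prim.sigmaOf S :=
  le_iSup₂_of_le k h le_rfl

theorem Primitives.measurable_Ws_sigmaOf {S : Set (Unit ⊕ ℕ ⊕ ℕ)} (t : ℕ)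
    (h : Sum.inr (Sum.inl t) ∈ S) : Measurable[prim.sigmaOf S, ⊤] (prim.Ws t) :=
  Measurable.of_comap_le (prim.sigma_le_sigmaOf h)

theorem Primitives.measurable_Wo_sigmaOf {S : Set (Unit ⊕ ℕ ⊕ ℕ)} (t : ℕ)
    (h : Sum.inr (Sum.inr t) ∈ S) : Measurable[prim.sigmaOf S, ⊤] (prim.Wo t) :=
  Measurable.of_comap_le (prim.sigma_le_sigmaOf h)

theorem Primitives.measurable_X₁_sigmaOf {S : Set (Unit ⊕ ℕ ⊕ ℕ)}
    (h : Sum.inl () ∈ S) : Measurable[prim.sigmaOf S, ⊤] prim.X₁ :=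
  Measurable.of_comap_le (prim.sigma_le_sigmaOf h)

/-- Mutually independent σ-algebras remain independent when grouped along disjoint index sets. -/
theorem Primitives.measure_inter {S S' : Set (Unit ⊕ ℕ ⊕ ℕ)} (h : Disjoint S S') {A A' : Set Ω}
    (hA : MeasurableSet[prim.sigmaOf S] A) (hA' : MeasurableSet[prim.sigmaOf S'] A') :
    P (A ∩ A') = P A * P A' :=
  (Indep_iff _ _ _).1 (indep_iSup_of_disjoint prim.sigma_le prim.indep h) A A' hA hA'

variable (Sys) in
/-- The first snapshot, as a function of the initial state and the first observation noise. -/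
def start (x : 𝓧) (w : 𝓦o) : Snapshot 𝓧 𝓜 𝓩 :=
  ⟨x, fun i => Sys.m₀ i (Sys.h x Sys.u₀ w i), []⟩

variable (Sys) in
/-- One step of the evolution, as a function of the noise. -/
def advance (ψ : CoordStrategy 𝓤 𝓜 𝓩) (q : Snapshot 𝓧 𝓜 𝓩) (w : 𝓦s × 𝓦o) : Snapshot 𝓧 𝓜 𝓩 :=
  let u : ∀ i, 𝓤 i := fun i => ψ q.c i (q.m i)
  let x' := Sys.f q.x u w.1
  let y' := Sys.h x' u w.2
  { x := x'
    m := fun i => Sys.ξ i (q.m i) (u i) (y' i)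
    c := q.c ++ [Sys.ζ q.m u y'] }

variable [Finite ι] [Finite 𝓧] [Finite 𝓦s] [Finite 𝓦o] [Finite 𝓩] [∀ i, Finite (𝓜 i)]

/-- The snapshot at time `t` involves the state noise before `t` and the observation noise up to
`t`. This makes it independent of `Ws t` and `Wo (t + 1)`, which drive the next step. -/
theorem measurable_traj (ψ : CoordStrategy 𝓤 𝓜 𝓩) (t : ℕ) :
    Measurable[prim.sigmaOf (past t), ⊤] (Sys.traj prim (fun c m i => ψ c i (m i)) t) := by
  induction t with
  | zero =>
    exact measurable_top_comp₂ (prim.measurable_X₁_sigmaOf (S := past 0) trivial)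
      (prim.measurable_Wo_sigmaOf (S := past 0) 0 (Nat.le_refl 0)) Sys.start
  | succ t ih =>
    have hsub : past t ⊆ past (t + 1) := by
      rintro (_ | s | s) hs
      · trivial
      · exact Nat.lt_succ_of_lt hs
      · exact Nat.le_succ_of_le hs
    exact measurable_top_comp₂ (ih.mono (prim.sigmaOf_mono hsub) le_rfl)
      (measurable_top_comp₂ (prim.measurable_Ws_sigmaOf (S := past (t + 1)) t (Nat.lt_succ_self t))
        (prim.measurable_Wo_sigmaOf (S := past (t + 1)) (t + 1) (Nat.le_refl (t + 1))) Prod.mk)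
      (Sys.advance ψ)

theorem measure_traj_preimage (ψ : CoordStrategy 𝓤 𝓜 𝓩) (t : ℕ) (q : Snapshot 𝓧 𝓜 𝓩) :
    P (Sys.traj prim (fun c m i => ψ c i (m i)) t ⁻¹' {q}) = Sys.snapLaw ψ t q := by
  induction t generalizing q with
  | zero =>
    have hlaw : (Sys.snapLaw ψ 0 : PMF (Snapshot 𝓧 𝓜 𝓩)) =
        Sys.PX.bind fun x => Sys.PWo.map (Sys.start x) := by
      rw [snapLaw, initBelief, PMF.map_bind]
      simp only [PMF.map_comp]
      rfl
    rw [hlaw]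
    refine PMF.measure_preimage_singleton_of_joint (X := prim.X₁) (Y := prim.Wo 0)
      (fun a b => (prim.measurable_X₁ trivial).inter (prim.measurable_Wo 0 trivial))
      (fun a b => ?_) Sys.start q
    rw [← prim.law_X₁, ← prim.law_Wo 0]
    exact prim.measure_inter (S := {Sum.inl ()}) (S' := {Sum.inr (Sum.inr 0)}) (by simp)
      (prim.measurable_X₁_sigmaOf (Set.mem_singleton _) trivial)
      (prim.measurable_Wo_sigmaOf 0 (Set.mem_singleton _) trivial)
  | succ t ih =>
    have hlaw : Sys.snapLaw ψ (t + 1) = (Sys.snapLaw ψ t).bind fun q =>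
        (Sys.PWo.bind fun wo => Sys.PWs.map fun ws => (ws, wo)).map
          (Sys.advance ψ q) := by
      rw [snapLaw]
      congr 1
      funext q
      -- The two noises are drawn in the opposite order in `transLaw`; this order fits
      -- `PMF.bind_map_mk_apply`.
      have hcomm : (Sys.PWo.bind fun wo => Sys.PWs.map fun ws => (ws, wo)) =
          Sys.PWs.bind fun ws => Sys.PWo.map fun wo => (ws, wo) :=
        PMF.bind_comm _ _ _
      rw [hcomm, transLaw, PMF.map_bind, PMF.map_bind]
      simp only [PMF.map_comp]
      rfl
    rw [hlaw]
    have htraj := measurable_traj prim ψ t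
    refine PMF.measure_preimage_singleton_of_joint
      (X := Sys.traj prim (fun c m i => ψ c i (m i)) t)
      (Y := fun ω => (prim.Ws t ω, prim.Wo (t + 1) ω))
      (fun a b => ?_) (fun a b => ?_) (Sys.advance ψ) q
    · exact (prim.sigmaOf_le _ _ (htraj trivial)).inter
        (measurable_top_comp₂ (prim.measurable_Ws t) (prim.measurable_Wo (t + 1)) Prod.mk trivial)
    · obtain ⟨w, w'⟩ := b
      have hpre : (fun ω => (prim.Ws t ω, prim.Wo (t + 1) ω)) ⁻¹' {(w, w')} =
          prim.Ws t ⁻¹' {w} ∩ prim.Wo (t + 1) ⁻¹' {w'} := by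
        ext ω
        simp
      rw [hpre, PMF.bind_map_mk_apply, ← ih, ← prim.law_Ws t, ← prim.law_Wo (t + 1), mul_comm
        (P (prim.Wo (t + 1) ⁻¹' {w'})), ← mul_assoc, ← Set.inter_assoc]
      -- Independence is used in two stages: `Ws t` is split off from the past, then `Wo (t + 1)`
      -- from the past enlarged by `Ws t`.
      have h1 : P (Sys.traj prim (fun c m i => ψ c i (m i)) t ⁻¹' {a} ∩ prim.Ws t ⁻¹' {w}) =
          P (Sys.traj prim (fun c m i => ψ c i (m i)) t ⁻¹' {a}) * P (prim.Ws t ⁻¹' {w}) :=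
        prim.measure_inter (S := past t) (S' := {Sum.inr (Sum.inl t)})
          (by simp [past]) (htraj trivial) (prim.measurable_Ws_sigmaOf t (Set.mem_singleton _) trivial)
      rw [← h1]
      refine prim.measure_inter (S := past t ∪ {Sum.inr (Sum.inl t)})
        (S' := {Sum.inr (Sum.inr (t + 1))}) (by simp [past]) ?_
        (prim.measurable_Wo_sigmaOf (t + 1) (Set.mem_singleton _) trivial)
      exact MeasurableSet.inter
        (prim.sigmaOf_mono Set.subset_union_left _ (htraj trivial))
        (prim.measurable_Ws_sigmaOf t (Set.mem_union_right _ (Set.mem_singleton _)) trivial)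

/-- The expectation of a bounded function of the state, the local and the common information. -/
theorem integral_traj [IsProbabilityMeasure P] (ψ : CoordStrategy 𝓤 𝓜 𝓩) (t : ℕ)
    {F : Snapshot 𝓧 𝓜 𝓩 → ℝ} {C : ℝ} (hF : ∀ q, |F q| ≤ C) :
    Integrable (fun ω => F (Sys.traj prim (fun c m i => ψ c i (m i)) t ω)) P ∧
      ∫ ω, F (Sys.traj prim (fun c m i => ψ c i (m i)) t ω) ∂P = pmfExp (Sys.snapLaw ψ t) F := by
  let _ : MeasurableSpace (Snapshot 𝓧 𝓜 𝓩) := ⊤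
  have hmeas : Measurable (Sys.traj prim (fun c m i => ψ c i (m i)) t) :=
    (measurable_traj prim ψ t).mono (prim.sigmaOf_le _) le_rfl
  have hmap : P.map (Sys.traj prim (fun c m i => ψ c i (m i)) t) =
      (Sys.snapLaw ψ t).toMeasure := by
    refine Measure.ext_of_singleton fun q => ?_
    rw [Measure.map_apply hmeas (MeasurableSet.singleton q), measure_traj_preimage,
      PMF.toMeasure_apply_singleton _ _ (MeasurableSet.singleton q)]
  have hFm : StronglyMeasurable F := (measurable_from_top (f := F)).stronglyMeasurable
  constructor
  · exact Integrable.of_bound (hFm.comp_measurable hmeas).aestronglyMeasurable C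
      (Filter.Eventually.of_forall fun ω => hF _)
  · rw [← integral_map_of_stronglyMeasurable hmeas hFm, hmap, PMF.integral_eq_tsum]
    · rfl
    · exact Integrable.of_bound hFm.aestronglyMeasurable C (Filter.Eventually.of_forall hF)

variable (dflt) in
/-- The cost of a coordination strategy, in terms of the information state. -/
theorem coordJ_eq_chainCost [∀ i, Finite (𝓤 i)] [IsProbabilityMeasure P]
    (ψ : CoordStrategy 𝓤 𝓜 𝓩) :
    Sys.coordJ prim ψ = Sys.chainCost dflt Prod.fst (fun s => ψ s.2)
      (fun s z => (Sys.reachStep dflt s.1 (ψ s.2) z, s.2 ++ [z])) (Sys.reachInit dflt, []) := by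
  obtain ⟨C, hC⟩ := Sys.exists_cost_bound
  let F : Snapshot 𝓧 𝓜 𝓩 → ℝ := fun q => Sys.cost q.x fun i => ψ q.c i (q.m i)
  have hF : ∀ q, |F q| ≤ C := fun q => hC _ _
  have hint := fun t => integral_traj prim ψ t hF
  -- Absolute summability justifies exchanging the expectation with the sum over time.
  have hsum : Summable fun t => ∫ ω, ‖Sys.β ^ t *
      F (Sys.traj prim (fun c m i => ψ c i (m i)) t ω)‖ ∂P := by
    have habs (t : ℕ) (ω : Ω) : ‖Sys.β ^ t *
        F (Sys.traj prim (fun c m i => ψ c i (m i)) t ω)‖ =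
        Sys.β ^ t * |F (Sys.traj prim (fun c m i => ψ c i (m i)) t ω)| := by
      rw [Real.norm_eq_abs, abs_mul, abs_of_pos (pow_pos Sys.β_pos t)]
    simp only [habs, integral_const_mul]
    refine summable_discounted (C := C) fun t => ?_
    rw [(integral_traj prim ψ t (F := fun q => |F q|) fun q => (abs_abs _).trans_le (hF q)).2]
    exact pmfExp.abs_le _ fun q => (abs_abs _).trans_le (hF q)
  have hcost : Sys.coordJ prim ψ = ∑' t, ∫ ω, Sys.β ^ t *
      F (Sys.traj prim (fun c m i => ψ c i (m i)) t ω) ∂P :=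
    (hasSum_integral_of_summable_integral_norm
      (fun t => (hint t).1.const_mul _) hsum).tsum_eq.symm
  rw [hcost, chainCost]
  refine tsum_congr fun t => ?_
  rw [integral_const_mul, (hint t).2, snapLaw_eq_bind (dflt := dflt), pmfExp.bind _ _ hF]
  congr 2
  funext s
  rw [pmfExp.map _ _ hF]
  rfl

end Trajectory
end PHSSystem
end

noncomputable section
universe u₁ u₂ u₃ u₄ u₅ u₆ u₇ u₈ u₉ u₁₀
namespace PHSSystem

variable {ι : Type u₁} {𝓧 : Type u₂} {𝓨 : ι → Type u₃} {𝓤 : ι → Type u₄}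
  {𝓦s : Type u₅} {𝓦o : Type u₆} {𝓜 : ι → Type u₇} {𝓩 : Type u₈}
  {Sys : PHSSystem ι 𝓧 𝓨 𝓤 𝓦s 𝓦o 𝓜 𝓩}
  {dflt : Belief 𝓧 𝓜 → Prescription 𝓤 𝓜 → 𝓩 → Belief 𝓧 𝓜} {𝓢 : Type u₁₀}

/-! ### Optimality -/

namespace IER

variable (R : IER Sys dflt 𝓢)

theorem stateLaw_eq_chainLaw (ψ : 𝓢 → Prescription 𝓤 𝓜) (t : ℕ) :
    R.stateLaw ψ t = Sys.chainLaw dflt R.B ψ (fun s z => R.next s (ψ s) z) R.sInit t := by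
  induction t with
  | zero => rfl
  | succ t ih => rw [stateLaw, chainLaw, ih]

theorem J_eq_chainCost (ψ : 𝓢 → Prescription 𝓤 𝓜) :
    R.J ψ = Sys.chainCost dflt R.B ψ (fun s z => R.next s (ψ s) z) R.sInit := by
  simp only [IER.J, stateLaw_eq_chainLaw]
  rfl

theorem B_sInit : R.B R.sInit = Sys.reachInit dflt :=
  (R.consistent []).symm

/-- `B` intertwines the dynamics at all states that can be generated from the initial one. -/
theorem B_next (hist : List (Prescription 𝓤 𝓜 × 𝓩)) (γ : Prescription 𝓤 𝓜) (z : 𝓩) :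
    R.B (R.next (hist.foldl (fun s a => R.next s a.1 a.2) R.sInit) γ z) =
      Sys.reachStep dflt (R.B (hist.foldl (fun s a => R.next s a.1 a.2) R.sInit)) γ z := by
  rw [← R.consistent hist]
  simpa using (R.consistent (hist ++ [(γ, z)])).symm

/-- Consistency speaks only of states generated from `s*`, and `𝓢` may contain others at which `B`
need not intertwine the dynamics. States of positive probability are of the good kind. -/
theorem exists_hist {ψ : 𝓢 → Prescription 𝓤 𝓜} {t : ℕ} {s : 𝓢}
    (hs : s ∈ (Sys.chainLaw dflt R.B ψ (fun s z => R.next s (ψ s) z) R.sInit t).support) :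
    ∃ hist : List (Prescription 𝓤 𝓜 × 𝓩),
      hist.foldl (fun s a => R.next s a.1 a.2) R.sInit = s := by
  induction t generalizing s with
  | zero => exact ⟨[], (mem_support_chainLaw_zero.1 hs).symm⟩
  | succ t ih =>
    obtain ⟨s', hs', z, -, rfl⟩ := mem_support_chainLaw_succ.1 hs
    obtain ⟨hist, rfl⟩ := ih hs'
    exact ⟨hist ++ [(ψ _, z)], by rw [List.foldl_concat]⟩

theorem B_next_of_mem_support {ψ : 𝓢 → Prescription 𝓤 𝓜} (t : ℕ) (s : 𝓢)
    (hs : s ∈ (Sys.chainLaw dflt R.B ψ (fun s z => R.next s (ψ s) z) R.sInit t).support) (z : 𝓩) :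
    R.B (R.next s (ψ s) z) = Sys.reachStep dflt (R.B s) (ψ s) z := by
  obtain ⟨hist, rfl⟩ := R.exists_hist hs
  exact R.B_next hist _ z

variable [Finite ι] [Finite 𝓧] [∀ i, Finite (𝓤 i)]

theorem value_le_J {V : Sys.ReachSet dflt → ℝ} (hV : Sys.IsBellmanSolution dflt V)
    (ψ : 𝓢 → Prescription 𝓤 𝓜) : V (Sys.reachInit dflt) ≤ R.J ψ := by
  rw [J_eq_chainCost, ← R.B_sInit]
  exact value_le_chainCost hV R.B_next_of_mem_support

theorem J_eq_value_iff {V : Sys.ReachSet dflt → ℝ} (hV : Sys.IsBellmanSolution dflt V)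
    (ψ : 𝓢 → Prescription 𝓤 𝓜) : R.J ψ = V (Sys.reachInit dflt) ↔
      ∀ t, ∀ s ∈ (R.stateLaw ψ t).support,
        Sys.stateActionValue dflt V (R.B s) (ψ s) = V (R.B s) := by
  simp only [J_eq_chainCost, ← R.B_sInit, stateLaw_eq_chainLaw]
  exact chainCost_eq_value_iff hV R.B_next_of_mem_support

theorem IsOptimal.J_eq_value {R : IER Sys dflt 𝓢} {V : Sys.ReachSet dflt → ℝ}
    (hV : Sys.IsBellmanSolution dflt V) {ψ : 𝓢 → Prescription 𝓤 𝓜} (hψ : R.IsOptimal ψ) :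
    R.J ψ = V (Sys.reachInit dflt) := by
  -- The competitor plays a Bellman minimizer at `B s` in every state `s`; all its gaps vanish, so
  -- it costs exactly `V(π_1)`.
  choose greedy hgreedy using hV.attained
  refine le_antisymm ((hψ fun s => greedy (R.B s)).trans_eq ?_) (R.value_le_J hV ψ)
  exact (R.J_eq_value_iff hV _).2 fun _ s _ => hgreedy (R.B s)

end IER

/-- Along the strategy given by `ψ`, the information state is the one generated from the common
information, and it is visited by `Δ` under `ψt` if `ψ` selects its values among the values of
`ψt` at visited states. -/
theorem mem_support_coordLaw_toCoord {R : IER Sys dflt 𝓢} {ψt : 𝓢 → Prescription 𝓤 𝓜}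
    {ψ : Sys.ReachSet dflt → Prescription 𝓤 𝓜}
    (hsel : ∀ t, ∀ s ∈ (R.stateLaw ψt t).support,
      ∃ t', ∃ s' ∈ (R.stateLaw ψt t').support, R.B s' = R.B s ∧ ψ (R.B s) = ψt s')
    {t : ℕ} {x : Sys.ReachSet dflt × List 𝓩}
    (hx : x ∈ (Sys.coordLaw dflt (Sys.toCoord dflt ψ) t).support) :
    x.1 = Sys.beliefAt dflt ψ x.2 ∧
      ∃ t', ∃ s ∈ (R.stateLaw ψt t').support, R.B s = x.1 ∧ ψ x.1 = ψt s := by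
  induction t generalizing x with
  | zero =>
    obtain rfl := mem_support_chainLaw_zero.1 hx
    refine ⟨rfl, ?_⟩
    have h := hsel 0 R.sInit (by simp [IER.stateLaw])
    rwa [R.B_sInit] at h
  | succ t ih =>
    obtain ⟨y, hy, z, hz, rfl⟩ := mem_support_chainLaw_succ.1 hx
    obtain ⟨hbel, t', s, hs, hBs, hψs⟩ := ih hy
    -- `toCoord` recomputes the information state from the observations; by induction it finds the
    -- first component of the chain.
    have hact : Sys.toCoord dflt ψ y.2 = ψ y.1 := by rw [toCoord, ← hbel]
    rw [hact] at hz ⊢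
    refine ⟨by simp [beliefAt, hbel], ?_⟩
    have hB : R.B (R.next s (ψt s) z) = Sys.reachStep dflt y.1 (ψ y.1) z := by
      rw [R.B_next_of_mem_support t' s (R.stateLaw_eq_chainLaw ψt t' ▸ hs), hBs, hψs]
    -- The observation has positive probability in `Δ` too, since its law depends only on the
    -- information state and the prescription, which agree.
    have hnext : R.next s (ψt s) z ∈ (R.stateLaw ψt (t' + 1)).support := by
      rw [IER.stateLaw, PMF.mem_support_bind_iff]
      refine ⟨s, hs, (PMF.mem_support_map_iff _ _ _).2 ⟨z, ?_, rfl⟩⟩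
      rwa [hBs, ← hψs]
    have h := hsel (t' + 1) _ hnext
    rwa [hB] at h

/-! ### Comparison of the coordinated system with `Δ` -/

section Coordinated

variable [Finite ι] [Finite 𝓧] [Finite 𝓦s] [Finite 𝓦o] [Finite 𝓩] [∀ i, Finite (𝓜 i)]
  [∀ i, Finite (𝓤 i)] {Ω : Type u₉} [MeasurableSpace Ω] {P : Measure Ω}
  [IsProbabilityMeasure P] (prim : Sys.Primitives P)

/-- The first component of the chain follows `φ` by construction, so the lower bound holds for every
history-dependent coordination strategy. -/
theorem value_le_coordJ {V : Sys.ReachSet dflt → ℝ} (hV : Sys.IsBellmanSolution dflt V)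
    (ψ : CoordStrategy 𝓤 𝓜 𝓩) : V (Sys.reachInit dflt) ≤ Sys.coordJ prim ψ := by
  rw [coordJ_eq_chainCost dflt]
  exact value_le_chainCost (b := Prod.fst) (s₀ := (Sys.reachInit dflt, [])) hV fun _ _ _ _ => rfl

theorem coordJ_eq_value_iff {V : Sys.ReachSet dflt → ℝ} (hV : Sys.IsBellmanSolution dflt V)
    (ψ : CoordStrategy 𝓤 𝓜 𝓩) : Sys.coordJ prim ψ = V (Sys.reachInit dflt) ↔
      ∀ t, ∀ s ∈ (Sys.coordLaw dflt ψ t).support,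
        Sys.stateActionValue dflt V s.1 (ψ s.2) = V s.1 := by
  rw [coordJ_eq_chainCost dflt]
  exact chainCost_eq_value_iff (b := Prod.fst) (s₀ := (Sys.reachInit dflt, [])) hV
    fun _ _ _ _ => rfl

/-- Optimality in `Δ` makes `ψt` greedy at visited states, and along its own path `ψ` only uses
prescriptions taken from such states, so both costs equal `V(π_1)`. The hypothesis `hsel` is the
common core of the two claims. -/
theorem optimal_of_selection {R : IER Sys dflt 𝓢} {ψt : 𝓢 → Prescription 𝓤 𝓜}
    (hψt : R.IsOptimal ψt) {ψ : Sys.ReachSet dflt → Prescription 𝓤 𝓜}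
    (hsel : ∀ t, ∀ s ∈ (R.stateLaw ψt t).support,
      ∃ t', ∃ s' ∈ (R.stateLaw ψt t').support, R.B s' = R.B s ∧ ψ (R.B s) = ψt s') :
    R.J ψt = Sys.coordJ prim (Sys.toCoord dflt ψ) ∧
      Sys.IsCoordOptimal prim (Sys.toCoord dflt ψ) ∧
      Sys.IsOptimal prim (Sys.toStrategy dflt ψ) := by
  obtain ⟨V, hV⟩ := Sys.exists_isBellmanSolution dflt
  have hJ := hψt.J_eq_value hV
  have hcoord : Sys.coordJ prim (Sys.toCoord dflt ψ) = V (Sys.reachInit dflt) := by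
    refine (coordJ_eq_value_iff prim hV _).2 fun t x hx => ?_
    obtain ⟨hbel, t', s, hs, hBs, hψs⟩ := mem_support_coordLaw_toCoord hsel hx
    have h := (R.J_eq_value_iff hV ψt).1 hJ t' s hs
    rw [hBs, ← hψs] at h
    rwa [toCoord, ← hbel]
  have hopt : Sys.IsCoordOptimal prim (Sys.toCoord dflt ψ) := fun ψ' =>
    hcoord.trans_le (value_le_coordJ prim hV ψ')
  -- A joint strategy and the coordination strategy with the same partial maps have the same cost by
  -- definition, so optimality transfers.
  exact ⟨hJ.trans hcoord.symm, hopt, fun g => hopt fun c i mi => g i c mi⟩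

end Coordinated

end PHSSystem
end

theorem lemma2 {n : ℕ} {𝓧 𝓦s 𝓦o 𝓩 : Type*} {𝓨 𝓤 𝓜 : Fin n → Type*}
    [Finite 𝓧] [Finite 𝓦s] [Finite 𝓦o] [Finite 𝓩]
    [∀ i, Finite (𝓨 i)] [∀ i, Finite (𝓤 i)] [∀ i, Finite (𝓜 i)]
    (Sys : PHSSystem (Fin n) 𝓧 𝓨 𝓤 𝓦s 𝓦o 𝓜 𝓩)
    {Ω : Type*} [MeasurableSpace Ω] (P : MeasureTheory.Measure Ω)
    [MeasureTheory.IsProbabilityMeasure P] (prim : Sys.Primitives P)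
    (dflt : PHSSystem.Belief 𝓧 𝓜 → PHSSystem.Prescription 𝓤 𝓜 → 𝓩 → PHSSystem.Belief 𝓧 𝓜)
    {𝓢 : Type*} (R : PHSSystem.IER Sys dflt 𝓢)
    (ψt : 𝓢 → PHSSystem.Prescription 𝓤 𝓜) (hψt : R.IsOptimal ψt) :
    (∀ ψ : Sys.ReachSet dflt → PHSSystem.Prescription 𝓤 𝓜,
      (∀ s, ψ (R.B s) = ψt s) →
        R.J ψt = Sys.coordJ prim (Sys.toCoord dflt ψ) ∧
        Sys.IsCoordOptimal prim (Sys.toCoord dflt ψ) ∧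
        Sys.IsOptimal prim (Sys.toStrategy dflt ψ)) ∧
    (∃ ψ : Sys.ReachSet dflt → PHSSystem.Prescription 𝓤 𝓜,
      (∀ π, ∃ s, R.B s = π ∧ ψ π = ψt s) ∧
        R.J ψt = Sys.coordJ prim (Sys.toCoord dflt ψ) ∧
        Sys.IsCoordOptimal prim (Sys.toCoord dflt ψ) ∧
        Sys.IsOptimal prim (Sys.toStrategy dflt ψ)) := by
  refine ⟨fun ψ hψ => PHSSystem.optimal_of_selection prim hψt fun t s hs =>
    ⟨t, s, hs, rfl, hψ s⟩, ?_⟩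
  -- The representative is a visited state if the fibre contains one, and arbitrary otherwise.
  have hchoice : ∀ π, ∃ s, R.B s = π ∧ ((∃ t, ∃ s' ∈ (R.stateLaw ψt t).support, R.B s' = π) →
      ∃ t, s ∈ (R.stateLaw ψt t).support) := by
    intro π
    by_cases h : ∃ t, ∃ s' ∈ (R.stateLaw ψt t).support, R.B s' = π
    · obtain ⟨t, s', hs', hB⟩ := h
      exact ⟨s', hB, fun _ => ⟨t, hs'⟩⟩
    · obtain ⟨s, hs⟩ := R.surjective_B π
      exact ⟨s, hs, fun h' => absurd h' h⟩
  choose σ hσ hsupp using hchoice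
  refine ⟨fun π => ψt (σ π), fun π => ⟨σ π, hσ π, rfl⟩,
    PHSSystem.optimal_of_selection prim hψt fun t s hs => ?_⟩
  obtain ⟨t', ht'⟩ := hsupp (R.B s) ⟨t, s, hs, rfl⟩
  exact ⟨t', σ (R.B s), ht', hσ _, rfl⟩
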